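/- Let $n\ge 2$. Let $p:\mathbb R^n\to(1,\infty)$ be a variable exponent that is bounded, $p^+:=\sup_{\mathbb R^n}p<\infty$, and such that $1/p$ is log-Hölder continuous, i.e. there is $L>0$ with $$\Big|\tfrac1{p(x)}-\tfrac1{p(y)}\Big|\le \frac{L}{\log(e+1/|x-y|)}\qquad\text{for all }x\ne y\text{ in }\mathbb R^n$$ (every bounded Lipschitz exponent satisfies this). Let $\mathcal A:\mathbb R^n\times\mathbb R\times\mathbb R^n\to\mathbb R^n$ be a Carathéodory function (measurable in the first argument and continuous in the latter two) of $p(\cdot)$-growth: there are measurable functions $a\le b$ on $\mathbb R^n$ and constants $a_->0$, $b^+<\infty$ with $a_-\le a$ and $b\le b^+$ such that for all $(x,t,\xi)$ $$\langle \mathcal A(x,t,\xi),\xi\rangle\ge a(x)|\xi|^{p(x)},\qquad |\mathcal A(x,t,\xi)|\le b(x)|\xi|^{p(x)-1}.$$ A function $u:\mathbb R^n\to\mathbb R$ is called $\mathcal A$-harmonic if it is continuous, belongs to $W^{1,p(\cdot)}_{loc}(\mathbb R^n)$ (that is, $u$ and its distributional gradient $\nabla u$ lie in $L^{p(\cdot)}(U)$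 for every bounded open $U\subset\mathbb R^n$, where $f\in L^{p(\cdot)}(U)$ means that $f$ is measurable and $\int_U|f/\mu|^{p(x)}dx<\infty$ for some $\mu>0$), and satisfies $$\int_{\mathbb R^n}\langle \mathcal A(x,u,\nabla u),\nabla\phi\rangle\,dx=0\qquad\text{for all }\phi\in C_0^\infty(\mathbb R^n).$$ Suppose that there are a constant $q\ge n$, a point $x_0\in\mathbb R^n$ and an increasing sequence of radii $R_k\to\infty$ $(k=1,2,\dots)$ such that $$p(x)=q\qquad\text{for all }x\in B(x_0,2R_k)\setminus B(x_0,R_k),\quad k=1,2,\dots$$ Then every bounded $\mathcal A$-harmonic function $u$ on $\mathbb R^n$ is constant. -/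

import Mathlib

open MeasureTheory Filter Topology
open scoped ENNReal

namespace VariableExponent

/-- The Euclidean space `ℝⁿ`. -/
abbrev Rn (n : ℕ) : Type := EuclideanSpace ℝ (Fin n)

/-- The test functions `C₀^∞(ℝⁿ)`: smooth real functions with compact support. -/
def IsTestFunction {n : ℕ} (φ : Rn n → ℝ) : Prop :=
  ContDiff ℝ ((⊤ : ℕ∞) : WithTop ℕ∞) φ ∧ HasCompactSupport φ

/-- Log-Hölder continuity on `ℝⁿ`: there is `L > 0` with
`|α(x) - α(y)| ≤ L / log(e + 1/|x - y|)` for all `x`, `y`.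
(At `x = y` the left side is `0` and the right side is nonnegative.) -/
def IsLogHolder {n : ℕ} (α : Rn n → ℝ) : Prop :=
  ∃ L : ℝ, 0 < L ∧ ∀ x y : Rn n,
    |α x - α y| ≤ L / Real.log (Real.exp 1 + 1 / dist x y)

/-- The admissible exponents: `1 < p(x) ≤ p⁺ < ∞` on `ℝⁿ`, and `1/p` is log-Hölder continuous. -/
structure IsLogHolderExponent {n : ℕ} (p : Rn n → ℝ) : Prop where
  one_lt : ∀ x, 1 < p x
  bounded : ∃ pplus : ℝ, ∀ x, p x ≤ pplus
  logHolder : IsLogHolder (fun x => 1 / p x)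

/-- The modular `∫_E |f(x)|^{p(x)} dx`, with values in `[0, ∞]`. -/
noncomputable def modular {n : ℕ} {F : Type*} [NormedAddCommGroup F]
    (p : Rn n → ℝ) (E : Set (Rn n)) (f : Rn n → F) : ℝ≥0∞ :=
  ∫⁻ x in E, ENNReal.ofReal (‖f x‖ ^ p x)

/-- Membership in `L^{p(·)}(E)`: `f` is (Lebesgue) measurable on `E` and the modular of `f / μ`
is finite for some `μ > 0`. -/
def MemLpVar {n : ℕ} {F : Type*} [NormedAddCommGroup F] [NormedSpace ℝ F]
    (p : Rn n → ℝ) (E : Set (Rn n)) (f : Rn n → F) : Prop :=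
  AEStronglyMeasurable f (volume.restrict E) ∧
    ∃ μ : ℝ, 0 < μ ∧ modular p E (fun x => μ⁻¹ • f x) < ∞

/-- `G` is the distributional gradient of `u` on `ℝⁿ`: both are locally integrable and
`∫ u ∇φ = - ∫ φ G` for every test function `φ`. -/
structure IsWeakGradient {n : ℕ} (u : Rn n → ℝ) (G : Rn n → Rn n) : Prop where
  locallyIntegrable : LocallyIntegrable u volume
  locallyIntegrable_grad : LocallyIntegrable G volume
  integral_eq : ∀ φ : Rn n → ℝ, IsTestFunction φ →
    ∫ x, u x • gradient φ x = - ∫ x, φ x • G x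

/-- `u ∈ W^{1,p(·)}_loc(ℝⁿ)` with distributional gradient `G` (which is unique up to
null sets): `u` and `G` belong to `L^{p(·)}(U)` for every bounded open set `U`. -/
structure MemW1pLoc {n : ℕ} (p : Rn n → ℝ) (u : Rn n → ℝ) (G : Rn n → Rn n) : Prop where
  weakGradient : IsWeakGradient u G
  memLp : ∀ U : Set (Rn n), IsOpen U → Bornology.IsBounded U → MemLpVar p U u
  memLp_grad : ∀ U : Set (Rn n), IsOpen U → Bornology.IsBounded U → MemLpVar p U G

/-- `A : ℝⁿ × ℝ × ℝⁿ → ℝⁿ` is a Carathéodory function: (Lebesgue) measurable in the first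
argument and continuous in the latter two arguments. -/
structure IsCaratheodory {n : ℕ} (A : Rn n → ℝ → Rn n → Rn n) : Prop where
  measurable : ∀ (t : ℝ) (ξ : Rn n), AEMeasurable (fun x => A x t ξ) volume
  continuous : ∀ x : Rn n, Continuous (fun tξ : ℝ × Rn n => A x tξ.1 tξ.2)

/-- `A` is a Carathéodory function of `p(·)`-growth: for some measurable `a ≤ b` with
`0 < a₋ ≤ a` and `b ≤ b⁺ < ∞`, `⟨A(x,t,ξ), ξ⟩ ≥ a(x) |ξ|^{p(x)}` and
`|A(x,t,ξ)| ≤ b(x) |ξ|^{p(x)-1}` for all `(x,t,ξ)`. -/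
structure HasNonstandardGrowth {n : ℕ} (p : Rn n → ℝ)
    (A : Rn n → ℝ → Rn n → Rn n) : Prop where
  caratheodory : IsCaratheodory A
  growth : ∃ a b : Rn n → ℝ, AEMeasurable a volume ∧ AEMeasurable b volume ∧
    (∃ aminus : ℝ, 0 < aminus ∧ ∀ x, aminus ≤ a x) ∧
    (∀ x, a x ≤ b x) ∧
    (∃ bplus : ℝ, ∀ x, b x ≤ bplus) ∧
    (∀ (x : Rn n) (t : ℝ) (ξ : Rn n), a x * ‖ξ‖ ^ p x ≤ inner ℝ (A x t ξ) ξ) ∧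
    (∀ (x : Rn n) (t : ℝ) (ξ : Rn n), ‖A x t ξ‖ ≤ b x * ‖ξ‖ ^ (p x - 1))

/-- `u` is `A`-harmonic on `ℝⁿ`: it is continuous, lies in `W^{1,p(·)}_loc(ℝⁿ)`, and
`∫ ⟨A(x, u, ∇u), ∇φ⟩ dx = 0` for all `φ ∈ C₀^∞(ℝⁿ)`. (For `A` of `p(·)`-growth the integrand
is always integrable, by `|A(x, u, ∇u)| ≤ b⁺ |∇u|^{p(x)-1}` and `∇u ∈ L^{p(·)}_loc`.) -/
def IsAHarmonic {n : ℕ} (p : Rn n → ℝ) (A : Rn n → ℝ → Rn n → Rn n)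
    (u : Rn n → ℝ) : Prop :=
  Continuous u ∧ ∃ G : Rn n → Rn n, MemW1pLoc p u G ∧
    ∀ φ : Rn n → ℝ, IsTestFunction φ →
      ∫ x, inner ℝ (A x (u x) (G x)) (gradient φ x) = 0

end VariableExponent

open scoped Convolution

/-! Write `g = |∇u|^p`. The equation is tested with `ζ u`, where `ζ = η^m` and `η` is a cutoff from
`B(x₀,R)` to `B(x₀,2R)`. The growth bounds and `|u| ≤ M` give `∫ ζ g ≤ C ∫ |∇u|^(p-1) |∇ζ|`. The
last integrand lives on the annulus, where `p = q` is constant, so Young's inequality with a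
parameter `δ` applies. Since `|∇η| ≤ c/R`, the cutoff contributes at most a multiple of `R^(n-q)`,
which is bounded because `q ≥ n`. The result is `exists_caccioppoli`: `∫ ζ g ≤ K (δ⁻¹ ∫_annulus ζ g
+ δ^(q-1))` with `K` independent of `R` and `δ`.

For `q = n` the cutoff term need not tend to zero, so the estimate is used twice in
`ae_eq_zero_of_caccioppoli`. A large `δ` absorbs the annulus term and shows that `g` is integrable
on the whole space. The annulus integrals then tend to zero, and letting `R → ∞` and afterwards `δ →
0` gives `∫ g = 0`. Hence `∇u = 0` and `u` is constant.

Log-Hölder continuity justifies the test function, since `ζ u` is only a Sobolev function. Its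
mollifications are smooth, and `exists_norm_convolution_rpow_le` bounds their modulars well enough
to pass to the limit in `integral_inner_eq_zero`. -/

/-- Dominated convergence with a convergent sequence of dominating functions. -/
theorem MeasureTheory.tendsto_integral_of_tendsto_bound {α : Type*} [MeasurableSpace α]
    {μ : Measure α} {F H : ℕ → α → ℝ} {f h : α → ℝ}
    (hF : ∀ k, AEStronglyMeasurable (F k) μ) (hH : ∀ k, Integrable (H k) μ) (hh : Integrable h μ)
    (hFH : ∀ k, ∀ᵐ x ∂μ, |F k x| ≤ H k x)
    (hFf : ∀ᵐ x ∂μ, Tendsto (fun k => F k x) atTop (𝓝 (f x)))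
    (hHh : ∀ᵐ x ∂μ, Tendsto (fun k => H k x) atTop (𝓝 (h x)))
    (hint : Tendsto (fun k => ∫ x, H k x ∂μ) atTop (𝓝 (∫ x, h x ∂μ))) :
    Tendsto (fun k => ∫ x, F k x ∂μ) atTop (𝓝 (∫ x, f x ∂μ)) := by
  have hFHall : ∀ᵐ x ∂μ, ∀ k, |F k x| ≤ H k x := ae_all_iff.2 hFH
  have hbound : ∀ᵐ x ∂μ, |f x| ≤ h x := by
    filter_upwards [hFHall, hFf, hHh] with x h1 h2 h3
    exact le_of_tendsto_of_tendsto' h2.abs h3 h1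
  have hFint : ∀ k, Integrable (F k) μ := fun k => (hH k).mono' (hF k) (hFH k)
  have hmin : Tendsto (fun k => ∫ x, min (H k x) (h x) ∂μ) atTop (𝓝 (∫ x, h x ∂μ)) := by
    refine tendsto_integral_of_dominated_convergence h
      (fun k => ((hH k).inf hh).aestronglyMeasurable) hh (fun k => ?_) ?_
    · filter_upwards [hFH k, hbound] with x h1 h2
      have h3 : 0 ≤ min (H k x) (h x) :=
        le_min ((abs_nonneg _).trans h1) ((abs_nonneg _).trans h2)
      rw [Real.norm_eq_abs, abs_of_nonneg h3]
      exact min_le_right _ _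
    · filter_upwards [hHh] with x h1
      simpa using h1.min (tendsto_const_nhds (x := h x))
  -- `|H - h| = H + h - 2 min(H, h)`, and the minimum is dominated by the fixed function `h`; so
  -- convergence of the integrals upgrades to `L¹` convergence.
  have hdiff : Tendsto (fun k => ∫ x, |H k x - h x| ∂μ) atTop (𝓝 0) := by
    have heq : ∀ k, ∫ x, |H k x - h x| ∂μ
        = ∫ x, H k x ∂μ + ∫ x, h x ∂μ - 2 * ∫ x, min (H k x) (h x) ∂μ := by
      intro k
      have h2 : Integrable (fun x => 2 * min (H k x) (h x)) μ := ((hH k).inf hh).const_mul 2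
      have h3 : Integrable (fun x => H k x + h x) μ := (hH k).add hh
      rw [← integral_add (hH k) hh, ← integral_const_mul, ← integral_sub h3 h2]
      refine integral_congr_ae (Eventually.of_forall fun x => ?_)
      rcases le_total (H k x) (h x) with h1 | h1
      · simp only [min_eq_left h1]
        rw [abs_of_nonpos (by linarith)]; ring
      · simp only [min_eq_right h1]
        rw [abs_of_nonneg (by linarith)]; ring
    simp_rw [heq]
    have := (hint.add (tendsto_const_nhds (x := ∫ x, h x ∂μ))).sub (hmin.const_mul 2)
    convert this using 2
    ring
  -- Truncating `F k` to `[-h, h]` makes ordinary dominated convergence applicable; the truncation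
  -- error is at most `|H k - h|`.
  have hcl : Tendsto (fun k => ∫ x, max (-h x) (min (F k x) (h x)) ∂μ) atTop
      (𝓝 (∫ x, f x ∂μ)) := by
    refine tendsto_integral_of_dominated_convergence h
      (fun k => (hh.neg.sup ((hFint k).inf hh)).aestronglyMeasurable) hh (fun k => ?_) ?_
    · filter_upwards [hbound] with x h2
      have h0 := (abs_nonneg _).trans h2
      rw [Real.norm_eq_abs, abs_le]
      exact ⟨le_max_left _ _, max_le (by linarith) (min_le_right _ _)⟩
    · filter_upwards [hFf, hbound] with x h1 h2
      have h3 := (tendsto_const_nhds (x := -h x)).max (h1.min (tendsto_const_nhds (x := h x)))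
      rwa [min_eq_left (abs_le.1 h2).2, max_eq_right (abs_le.1 h2).1] at h3
  have herr : Tendsto (fun k => ∫ x, (F k x - max (-h x) (min (F k x) (h x))) ∂μ) atTop
      (𝓝 0) := by
    refine squeeze_zero_norm (fun k => ?_) hdiff
    refine norm_integral_le_of_norm_le ((hH k).sub hh).abs ?_
    filter_upwards [hFH k, hbound] with x h1 h2
    have h0 := (abs_nonneg _).trans h2
    rw [Real.norm_eq_abs]
    obtain ⟨h3, h4⟩ := abs_le.1 h1
    rcases le_total (F k x) (h x) with h5 | h5
    · rcases le_total (-h x) (F k x) with h6 | h6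
      · rw [min_eq_left h5, max_eq_right h6, sub_self, abs_zero]
        exact abs_nonneg _
      · rw [min_eq_left h5, max_eq_left h6, abs_of_nonpos (by linarith)]
        exact le_trans (by linarith) (le_abs_self _)
    · rw [min_eq_right h5, max_eq_right (by linarith), abs_of_nonneg (by linarith)]
      exact le_trans (by linarith) (le_abs_self _)
  have := herr.add hcl
  simp only [zero_add] at this
  refine this.congr fun k => ?_
  have h1 : Integrable (fun x => max (-h x) (min (F k x) (h x))) μ :=
    hh.neg.sup ((hFint k).inf hh)
  rw [integral_sub (hFint k) h1]
  simp

/-! ### Log-Hölder exponents -/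

namespace VariableExponent

variable {n : ℕ} {p : Rn n → ℝ}

/-- Multiplying the oscillation of `1/p` by `p x * p y ≤ P²` transfers log-Hölder continuity from
`1/p` to `p`. -/
theorem IsLogHolderExponent.exists_abs_sub_le (hp : IsLogHolderExponent p) :
    ∃ L : ℝ, 0 < L ∧ ∀ ε : ℝ, 0 < ε → ∀ x y : Rn n, dist x y ≤ ε →
      |p x - p y| ≤ L / Real.log (Real.exp 1 + 1 / ε) := by
  obtain ⟨P, hP⟩ := hp.bounded
  obtain ⟨L, hL, hLp⟩ := hp.logHolder
  have hP0 : 0 < P := lt_trans zero_lt_one ((hp.one_lt 0).trans_le (hP 0))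
  refine ⟨P * P * L, by positivity, fun ε hε x y hxy => ?_⟩
  have hlog : ∀ r : ℝ, 0 < r → 0 < Real.log (Real.exp 1 + 1 / r) := fun r hr =>
    Real.log_pos (by
      have := Real.add_one_le_exp 1
      have : 0 < 1 / r := by positivity
      linarith)
  rcases eq_or_ne x y with rfl | hne
  · simp only [sub_self, abs_zero]
    have := hlog ε hε
    positivity
  have hd : 0 < dist x y := dist_pos.2 hne
  have hx := hp.one_lt x
  have hy := hp.one_lt y
  have heq : |p x - p y| = p x * p y * |1 / p x - 1 / p y| := by
    have h0 : 0 < p x * p y := by positivity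
    have h1 : p x - p y = -(p x * p y * (1 / p x - 1 / p y)) := by field_simp; ring
    rw [h1, abs_neg, abs_mul, abs_of_pos h0]
  rw [heq, mul_div_assoc]
  have h1 := hLp x y
  have h2 : L / Real.log (Real.exp 1 + 1 / dist x y) ≤ L / Real.log (Real.exp 1 + 1 / ε) := by
    apply div_le_div_of_nonneg_left hL.le (hlog ε hε)
    apply Real.log_le_log (by positivity)
    gcongr
  have := hP x
  have := hP y
  have := h1.trans h2
  gcongr

theorem IsLogHolderExponent.continuous (hp : IsLogHolderExponent p) : Continuous p := by
  obtain ⟨L, hL, h⟩ := hp.exists_abs_sub_le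
  rw [Metric.continuous_iff]
  intro b η hη
  have hlim : Tendsto (fun ε : ℝ => L / Real.log (Real.exp 1 + 1 / ε)) (𝓝[>] 0) (𝓝 0) := by
    refine Tendsto.const_div_atTop (Real.tendsto_log_atTop.comp ?_) L
    refine tendsto_atTop_add_const_left _ _ ?_
    exact tendsto_inv_nhdsGT_zero.congr fun x => (one_div x).symm
  obtain ⟨ε, h1, h2⟩ := ((hlim.eventually (gt_mem_nhds hη)).and self_mem_nhdsWithin).exists
  exact ⟨ε, h2, fun a ha => (h ε h2 a b ha.le).trans_lt h1⟩

/-- At scale `ε`, `log T` is at most a multiple of `log(e + 1/ε)`, while `p` oscillates by at most a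
multiple of its reciprocal. The product of the two is bounded. The range of `T` is the one reached
by averages against a mollifier of radius `ε`. -/
theorem IsLogHolderExponent.exists_rpow_sub_le (hp : IsLogHolderExponent p) (K : ℝ) :
    ∃ C : ℝ, 0 < C ∧ ∀ ε : ℝ, 0 < ε → ∀ T : ℝ, 1 ≤ T → T ≤ K * (1 / ε) ^ n →
      ∀ x y : Rn n, dist x y ≤ ε → T ^ (p x - p y) ≤ C := by
  obtain ⟨L, hL, h⟩ := hp.exists_abs_sub_le
  refine ⟨Real.exp ((Real.log (max K 1) + n) * L), Real.exp_pos _, ?_⟩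
  intro ε hε T hT hTK x y hxy
  have hi : 0 < 1 / ε := by positivity
  set Λ := Real.log (Real.exp 1 + 1 / ε) with hΛ
  have hΛ1 : 1 ≤ Λ := by
    rw [hΛ, Real.le_log_iff_exp_le (by positivity)]
    linarith
  have hlogε : Real.log (1 / ε) ≤ Λ := Real.log_le_log hi (by linarith [Real.exp_pos 1])
  have hK : 0 ≤ Real.log (max K 1) := Real.log_nonneg (le_max_right _ _)
  have hlogT : Real.log T ≤ (Real.log (max K 1) + n) * Λ := by
    calc Real.log T ≤ Real.log (max K 1 * (1 / ε) ^ n) := by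
          apply Real.log_le_log (by linarith)
          refine hTK.trans ?_
          gcongr
          exact le_max_left _ _
      _ = Real.log (max K 1) + n * Real.log (1 / ε) := by
          rw [Real.log_mul (by positivity) (by positivity), Real.log_pow]
      _ ≤ Real.log (max K 1) * Λ + n * Λ := by
          gcongr
          exact le_mul_of_one_le_right hK hΛ1
      _ = _ := by ring
  rw [Real.rpow_def_of_pos (by linarith), Real.exp_le_exp]
  have hlog0 : 0 ≤ Real.log T := Real.log_nonneg hT
  calc Real.log T * (p x - p y) ≤ Real.log T * |p x - p y| := by
        gcongr
        exact le_abs_self _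
    _ ≤ ((Real.log (max K 1) + n) * Λ) * (L / Λ) := by
        gcongr
        exact h ε hε x y hxy
    _ = _ := by field_simp

/-! ### Mollification and the modular -/

theorem locallyIntegrable_norm {F : Type*} [NormedAddCommGroup F] {g : Rn n → F}
    (hg : LocallyIntegrable g volume) : LocallyIntegrable (fun x => ‖g x‖) volume := fun x => by
  obtain ⟨s, hs, h⟩ := hg x
  exact ⟨s, hs, h.norm⟩

theorem integrable_smul_comp_sub {F : Type*} [NormedAddCommGroup F] [NormedSpace ℝ F]
    {ρ : Rn n → ℝ} (hρ : Continuous ρ) (hρc : HasCompactSupport ρ) {g : Rn n → F}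
    (hg : LocallyIntegrable g volume) (x : Rn n) :
    Integrable (fun t => ρ t • g (x - t)) volume := by
  have := (hρc.convolutionExists_left (ContinuousLinearMap.lsmul ℝ ℝ) hρ hg) x
  simpa [ConvolutionExistsAt] using this

/-- Where `s > τ`, multiply `s` by `(s/τ)^(r-1) ≥ 1`. This replaces Jensen's inequality, which is
not available when the exponent varies with the point. -/
theorem le_add_rpow_mul {s τ r : ℝ} (hs : 0 ≤ s) (hτ : 0 < τ) (hr : 1 ≤ r) :
    s ≤ τ + s ^ r * τ ^ (1 - r) := by
  rcases le_or_gt s τ with h | h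
  · have : 0 ≤ s ^ r * τ ^ (1 - r) := by positivity
    linarith
  · have hs' : 0 < s := hτ.trans h
    have h1 : s ^ r * τ ^ (1 - r) = s * (s / τ) ^ (r - 1) := by
      rw [Real.div_rpow hs hτ.le, show (1 - r) = -(r - 1) by ring, Real.rpow_neg hτ.le,
        Real.rpow_sub_one hs'.ne']
      field_simp
    have h2 : 1 ≤ (s / τ) ^ (r - 1) :=
      Real.one_le_rpow ((one_le_div hτ).2 h.le) (by linarith)
    rw [h1]
    nlinarith

theorem le_one_add_rpow {s r : ℝ} (hs : 0 ≤ s) (hr : 1 ≤ r) : s ≤ 1 + s ^ r := by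
  simpa using le_add_rpow_mul hs one_pos hr

/-- Pointwise bound of the modular of a mollification by the mollified modular. -/
theorem IsLogHolderExponent.exists_norm_convolution_rpow_le (hp : IsLogHolderExponent p)
    {F : Type*} [NormedAddCommGroup F] [NormedSpace ℝ F] {w : Rn n → F}
    (hw : LocallyIntegrable w volume) (hwp : Integrable (fun x => ‖w x‖ ^ p x) volume) :
    ∃ C : ℝ, 0 < C ∧ ∀ φ : ContDiffBump (0 : Rn n), φ.rOut ≤ 1 → φ.rOut ≤ 2 * φ.rIn → ∀ x,
      ‖(φ.normed volume ⋆[ContinuousLinearMap.lsmul ℝ ℝ, volume] w) x‖ ^ p x ≤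
        C * (1 + (φ.normed volume ⋆[ContinuousLinearMap.lsmul ℝ ℝ, volume]
          fun y => ‖w y‖ ^ p y) x) := by
  obtain ⟨P, hP⟩ := hp.bounded
  have hP1 : 1 < P := (hp.one_lt 0).trans_le (hP 0)
  set I := ∫ x, ‖w x‖ ^ p x with hI
  have hI0 : 0 ≤ I := integral_nonneg fun x => by positivity
  set V := volume.real (Metric.closedBall (0 : Rn n) 1) with hV
  have hVpos : 0 < V :=
    ENNReal.toReal_pos (Metric.measure_closedBall_pos _ _ one_pos).ne' measure_closedBall_lt_top.ne
  set K := 1 + 2 ^ n / V * I with hK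
  obtain ⟨C, hC, hCb⟩ := hp.exists_rpow_sub_le K
  refine ⟨2 ^ P * (1 + C), by positivity, fun φ hφ1 hφ2 x => ?_⟩
  set ρ := φ.normed volume with hρ
  have hρ0 : ∀ t, 0 ≤ ρ t := fun t => φ.nonneg_normed t
  have hρcont : Continuous ρ := φ.continuous_normed
  have hρcomp : HasCompactSupport ρ := φ.hasCompactSupport_normed
  have hρint : Integrable ρ volume := φ.integrable_normed
  have hρone : ∫ t, ρ t = 1 := φ.integral_normed
  set ε := φ.rOut with hε
  have hε0 : 0 < ε := φ.rOut_pos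
  have hρle : ∀ t, ρ t ≤ 2 ^ n / V * (1 / ε) ^ n := by
    intro t
    have h1 := φ.normed_le_div_measure_closedBall_rOut volume 2 hφ2 t
    rw [Measure.addHaar_real_closedBall' _ _ hε0.le] at h1
    simp only [finrank_euclideanSpace, Fintype.card_fin] at h1
    refine h1.trans (le_of_eq ?_)
    rw [← hV, one_div, inv_pow]
    field_simp
  have hi1 : Integrable (fun t => ρ t * ‖w (x - t)‖) volume := by
    simpa using integrable_smul_comp_sub hρcont hρcomp (locallyIntegrable_norm hw) x
  have hi2 : Integrable (fun t => ρ t * ‖w (x - t)‖ ^ p (x - t)) volume := by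
    simpa using integrable_smul_comp_sub hρcont hρcomp hwp.locallyIntegrable x
  set T := ∫ t, ρ t * ‖w (x - t)‖ with hT
  have hconvT : ‖(ρ ⋆[ContinuousLinearMap.lsmul ℝ ℝ, volume] w) x‖ ≤ T := by
    rw [convolution_lsmul]
    refine (norm_integral_le_integral_norm _).trans (le_of_eq ?_)
    refine integral_congr_ae (Eventually.of_forall fun t => ?_)
    simp [norm_smul, abs_of_nonneg (hρ0 t)]
  set Φ := (ρ ⋆[ContinuousLinearMap.lsmul ℝ ℝ, volume] fun y => ‖w y‖ ^ p y) x with hΦ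
  have hΦeq : Φ = ∫ t, ρ t * ‖w (x - t)‖ ^ p (x - t) := by
    rw [hΦ, convolution_lsmul]; simp
  have hΦ0 : 0 ≤ Φ := by
    rw [hΦeq]
    exact integral_nonneg fun t => mul_nonneg (hρ0 t) (by positivity)
  have hp0 : 0 < p x := by linarith [hp.one_lt x]
  have hT0 : 0 ≤ T := (norm_nonneg _).trans hconvT
  have h2P : (1 : ℝ) ≤ 2 ^ P := Real.one_le_rpow (by norm_num) (by linarith)
  have h2p : (2 : ℝ) ^ p x ≤ 2 ^ P := Real.rpow_le_rpow_of_exponent_le (by norm_num) (hP x)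
  refine (Real.rpow_le_rpow (norm_nonneg _) hconvT hp0.le).trans ?_
  -- Small averages are covered by the `1` in the bound; the other case ensures `τ = T/2 ≥ 1`, as
  -- `hCb` requires. The half lets the term `τ` in `hmain` be absorbed into `T`.
  rcases le_or_gt T 2 with hT2 | hT2
  · calc T ^ p x ≤ 2 ^ p x := Real.rpow_le_rpow hT0 hT2 hp0.le
      _ ≤ 2 ^ P := h2p
      _ ≤ 2 ^ P * (1 + C) * (1 + Φ) := by
        have : 1 ≤ (1 + C) * (1 + Φ) := by nlinarith
        nlinarith
  set τ := T / 2 with hτ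
  have hτ1 : 1 ≤ τ := by rw [hτ]; linarith
  have hτ0 : 0 < τ := by linarith
  -- A priori bound: `T ≤ 1 + Φ`, and `Φ` is at most the supremum of the mollifier times the full
  -- modular `I`.
  have hTK : T ≤ K * (1 / ε) ^ n := by
    have hone : 1 ≤ (1 / ε) ^ n := one_le_pow₀ (by rw [le_div_iff₀ hε0]; linarith)
    have h1 : T ≤ 1 + Φ := by
      rw [hT, hΦeq, ← hρone, ← integral_add hρint hi2]
      refine integral_mono hi1 (hρint.add hi2) fun t => ?_
      have := mul_le_mul_of_nonneg_left
        (le_one_add_rpow (norm_nonneg (w (x - t))) (hp.one_lt (x - t)).le) (hρ0 t)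
      simpa [mul_add] using this
    have h2 : Φ ≤ 2 ^ n / V * (1 / ε) ^ n * I := by
      rw [hΦeq, hI, ← integral_sub_left_eq_self (fun y => ‖w y‖ ^ p y) volume x,
        ← integral_const_mul]
      refine integral_mono hi2 ((hwp.comp_sub_left x).const_mul _) fun t => ?_
      exact mul_le_mul_of_nonneg_right (hρle t) (by positivity)
    rw [hK]
    nlinarith
  have hpt : ∀ t, ρ t * ‖w (x - t)‖ ≤
      τ * ρ t + C * τ ^ (1 - p x) * (ρ t * ‖w (x - t)‖ ^ p (x - t)) := by
    intro t
    by_cases ht : ρ t = 0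
    · simp [ht]
    have htm : t ∈ Metric.ball (0 : Rn n) ε := by
      rw [hε, ← φ.support_normed_eq (μ := volume)]; exact ht
    have hdist : dist x (x - t) ≤ ε := by
      rw [dist_eq_norm]; simpa using (Metric.mem_ball.1 htm).le
    have h1 := le_add_rpow_mul (norm_nonneg (w (x - t))) hτ0 (hp.one_lt (x - t)).le
    -- Log-Hölder continuity freezes the exponent at the centre `x`, at the cost of the factor `C`.
    have h2 : τ ^ (1 - p (x - t)) ≤ C * τ ^ (1 - p x) := by
      rw [show 1 - p (x - t) = (p x - p (x - t)) + (1 - p x) by ring, Real.rpow_add hτ0]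
      gcongr
      exact hCb ε hε0 τ hτ1 (by rw [hτ]; linarith) x _ hdist
    have h3 : ‖w (x - t)‖ ≤ τ + ‖w (x - t)‖ ^ p (x - t) * (C * τ ^ (1 - p x)) :=
      h1.trans (by gcongr)
    have := mul_le_mul_of_nonneg_left h3 (hρ0 t)
    linarith
  have hmain : T ≤ τ + C * τ ^ (1 - p x) * Φ := by
    have := integral_mono hi1 ((hρint.const_mul τ).add (hi2.const_mul (C * τ ^ (1 - p x)))) hpt
    simp only [Pi.add_apply] at this
    rw [integral_add (hρint.const_mul τ) (hi2.const_mul _), integral_const_mul,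
      integral_const_mul, hρone, ← hΦeq] at this
    linarith
  have h4 : τ ≤ C * τ ^ (1 - p x) * Φ := by linarith
  have h5 : τ ^ p x ≤ C * Φ := by
    have h6 := mul_le_mul_of_nonneg_left h4 (Real.rpow_nonneg hτ0.le (p x - 1))
    have h7 : τ ^ (p x - 1) * τ = τ ^ p x := by
      rw [← Real.rpow_add_one hτ0.ne']; congr 1; ring
    have h8 : τ ^ (p x - 1) * τ ^ (1 - p x) = 1 := by
      rw [← Real.rpow_add hτ0]; simp
    rw [h7] at h6
    calc _ ≤ _ := h6
      _ = (τ ^ (p x - 1) * τ ^ (1 - p x)) * (C * Φ) := by ring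
      _ = _ := by rw [h8, one_mul]
  calc T ^ p x = 2 ^ p x * τ ^ p x := by
        rw [← Real.mul_rpow (by norm_num) hτ0.le]; congr 1; rw [hτ]; ring
    _ ≤ 2 ^ P * (C * Φ) := by gcongr
    _ ≤ 2 ^ P * (1 + C) * (1 + Φ) := by
        rw [mul_assoc]
        gcongr <;> linarith

/-! ### Calculus of test functions -/

namespace IsTestFunction

variable {φ ψ : Rn n → ℝ}

theorem continuous (h : IsTestFunction φ) : Continuous φ := h.1.continuous

theorem differentiableAt (h : IsTestFunction φ) (x : Rn n) : DifferentiableAt ℝ φ x :=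
  h.1.contDiffAt.differentiableAt (by simp)

theorem continuous_gradient (h : IsTestFunction φ) : Continuous (gradient φ) :=
  (InnerProductSpace.toDual ℝ (Rn n)).symm.continuous.comp (h.1.continuous_fderiv (by simp))

theorem hasCompactSupport_gradient (h : IsTestFunction φ) : HasCompactSupport (gradient φ) :=
  (h.2.fderiv (𝕜 := ℝ)).comp_left (g := (InnerProductSpace.toDual ℝ (Rn n)).symm) (map_zero _)

theorem mul (h : IsTestFunction φ) (h' : IsTestFunction ψ) :
    IsTestFunction (fun x => φ x * ψ x) :=
  ⟨h.1.mul h'.1, h.2.mul_right⟩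

theorem gradient_mul (h : IsTestFunction φ) (h' : IsTestFunction ψ) (x : Rn n) :
    gradient (fun x => φ x * ψ x) x = φ x • gradient ψ x + ψ x • gradient φ x := by
  refine ext_inner_right ℝ fun y => ?_
  rw [inner_gradient_left, inner_add_left, real_inner_smul_left, real_inner_smul_left,
    inner_gradient_left, inner_gradient_left,
    fderiv_fun_mul (h.differentiableAt x) (h'.differentiableAt x)]
  simp

theorem pow (h : IsTestFunction φ) {s : ℕ} (hs : s ≠ 0) : IsTestFunction (fun x => φ x ^ s) :=
  ⟨h.1.pow s, h.2.comp_left (g := fun t : ℝ => t ^ s) (zero_pow hs)⟩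

theorem gradient_pow (h : IsTestFunction φ) (s : ℕ) (x : Rn n) :
    gradient (fun x => φ x ^ s) x = (s * φ x ^ (s - 1)) • gradient φ x := by
  refine ext_inner_right ℝ fun y => ?_
  rw [inner_gradient_left, real_inner_smul_left, inner_gradient_left,
    fderiv_fun_pow s (h.differentiableAt x)]
  simp

theorem const_sub (h : IsTestFunction φ) (x : Rn n) : IsTestFunction (fun t => φ (x - t)) :=
  ⟨h.1.comp (contDiff_const.sub contDiff_id), h.2.comp_homeomorph (Homeomorph.subLeft x)⟩

theorem inner_gradient_const_sub (h : IsTestFunction φ) (x t y : Rn n) :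
    inner ℝ (gradient (fun t => φ (x - t)) t) y = - fderiv ℝ φ (x - t) y := by
  rw [inner_gradient_left]
  have h1 : HasFDerivAt (fun t : Rn n => x - t) (-ContinuousLinearMap.id ℝ (Rn n)) t :=
    (hasFDerivAt_id t).const_sub x
  have h2 := ((h.differentiableAt (x - t)).hasFDerivAt).comp t h1
  have h3 : fderiv ℝ (fun t => φ (x - t)) t
      = (fderiv ℝ φ (x - t)).comp (-ContinuousLinearMap.id ℝ (Rn n)) := h2.fderiv
  rw [h3]
  simp

theorem normed (φ : ContDiffBump (0 : Rn n)) : IsTestFunction (φ.normed volume) :=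
  ⟨φ.contDiff_normed, φ.hasCompactSupport_normed⟩

end IsTestFunction

/-! ### Weak gradients -/

namespace IsWeakGradient

variable {u : Rn n → ℝ} {G : Rn n → Rn n}

/-- Mollification commutes with the weak gradient. -/
theorem hasGradientAt_convolution (h : IsWeakGradient u G) {ρ : Rn n → ℝ}
    (hρ : IsTestFunction ρ) (x : Rn n) :
    HasGradientAt (ρ ⋆[ContinuousLinearMap.lsmul ℝ ℝ, volume] u)
      ((ρ ⋆[ContinuousLinearMap.lsmul ℝ ℝ, volume] G) x) x := by
  have h1 := hρ.2.hasFDerivAt_convolution_left (ContinuousLinearMap.lsmul ℝ ℝ)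
    (hρ.1.of_le (by simp)) h.locallyIntegrable x
  rw [hasGradientAt_iff_hasFDerivAt]
  convert! h1 using 1
  ext y
  have hex := ((hρ.2.fderiv (𝕜 := ℝ)).convolutionExists_left
    ((ContinuousLinearMap.lsmul ℝ ℝ).precompL (Rn n)) (hρ.1.continuous_fderiv (by simp))
    h.locallyIntegrable) x
  have hψ := hρ.const_sub x
  have hi1 := h.locallyIntegrable.integrable_smul_right_of_hasCompactSupport
    hψ.continuous_gradient hψ.hasCompactSupport_gradient
  -- Using `t ↦ ρ (x - t)` as test function moves the derivative from the mollifier to `u`.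
  have heq := h.integral_eq _ hψ
  rw [convolution_eq_swap, convolution_eq_swap,
    ContinuousLinearMap.integral_apply (by exact hex.integrable_swap)]
  simp only [InnerProductSpace.toDual_apply_apply, ContinuousLinearMap.lsmul_apply]
  have h2 : ∫ t, ρ (x - t) • G t = - ∫ t, u t • gradient (fun t => ρ (x - t)) t := by
    rw [heq, neg_neg]
  rw [h2, inner_neg_left, real_inner_comm, ← integral_inner hi1, ← integral_neg]
  refine integral_congr_ae (Eventually.of_forall fun t => ?_)
  simp only
  rw [real_inner_comm, real_inner_smul_left, hρ.inner_gradient_const_sub]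
  simp [ContinuousLinearMap.precompL_apply, mul_comm]

/-- The product `ζ φ` is itself a test function; expanding its gradient in the weak identity for `u`
gives the Leibniz rule. -/
theorem mul_testFunction (h : IsWeakGradient u G) {ζ : Rn n → ℝ} (hζ : IsTestFunction ζ) :
    IsWeakGradient (fun x => ζ x * u x) (fun x => ζ x • G x + u x • gradient ζ x) where
  locallyIntegrable := by
    have := h.locallyIntegrable.integrable_smul_left_of_hasCompactSupport hζ.continuous hζ.2
    exact this.locallyIntegrable
  locallyIntegrable_grad := by
    have h1 := h.locallyIntegrable_grad.integrable_smul_left_of_hasCompactSupport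
      hζ.continuous hζ.2
    have h2 := h.locallyIntegrable.integrable_smul_right_of_hasCompactSupport
      hζ.continuous_gradient hζ.hasCompactSupport_gradient
    exact (h1.add h2).locallyIntegrable
  integral_eq φ hφ := by
    have hm := hζ.mul hφ
    have h1 := h.locallyIntegrable.integrable_smul_right_of_hasCompactSupport
      hm.continuous_gradient hm.hasCompactSupport_gradient
    have h2 : Integrable (fun x => φ x • u x • gradient ζ x) volume := by
      have := h.locallyIntegrable.integrable_smul_right_of_hasCompactSupport
        (hφ.continuous.smul hζ.continuous_gradient) (hφ.2.smul_right (f' := gradient ζ))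
      refine this.congr (Eventually.of_forall fun x => ?_)
      simp only [Pi.smul_apply', smul_smul, mul_comm]
    have h3 : Integrable (fun x => φ x • ζ x • G x) volume := by
      have := h.locallyIntegrable_grad.integrable_smul_left_of_hasCompactSupport
        hm.continuous hm.2
      refine this.congr (Eventually.of_forall fun x => ?_)
      simp only [smul_smul, mul_comm]
    have h4 : ∀ x, (ζ x * u x) • gradient φ x
        = u x • gradient (fun x => ζ x * φ x) x - φ x • u x • gradient ζ x := by
      intro x
      rw [hζ.gradient_mul hφ, smul_add, smul_smul, smul_smul, smul_smul]
      simp only [mul_comm, add_sub_cancel_right]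
    simp_rw [h4, smul_add]
    rw [integral_sub h1 h2, integral_add h3 h2, h.integral_eq _ hm]
    simp only [mul_smul, neg_add, sub_eq_add_neg]
    congr 2
    refine integral_congr_ae (Eventually.of_forall fun x => ?_)
    simp only [smul_smul, mul_comm]

/-- A continuous function with vanishing weak gradient is constant. -/
theorem eq_of_ae_eq_zero (h : IsWeakGradient u G) (hu : Continuous u) (hG : G =ᵐ[volume] 0)
    (x y : Rn n) : u x = u y := by
  let φ : ℕ → ContDiffBump (0 : Rn n) := fun k =>
    ⟨1 / (k + 1) / 2, 1 / (k + 1), by positivity, half_lt_self (by positivity)⟩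
  have hφ : Tendsto (fun k => (φ k).rOut) atTop (𝓝 0) :=
    tendsto_one_div_add_atTop_nhds_zero_nat
  have hlim := fun z => ContDiffBump.convolution_tendsto_right_of_continuous
    (μ := volume) hφ hu z
  -- Each mollification has zero gradient, hence equal values at `x` and `y`; continuity of `u`
  -- makes the mollifications converge at both points.
  refine tendsto_nhds_unique ((hlim x).congr fun k => ?_) (hlim y)
  have hgrad := fun z => h.hasGradientAt_convolution (IsTestFunction.normed (φ k)) z
  have hzero : ∀ z, ((φ k).normed volume ⋆[ContinuousLinearMap.lsmul ℝ ℝ, volume] G) z = 0 := by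
    intro z
    rw [convolution_congr _ (EventuallyEq.refl _ _) hG]
    simp
  refine is_const_of_fderiv_eq_zero (𝕜 := ℝ) (fun z => (hgrad z).differentiableAt) (fun z => ?_) x y
  have := (hgrad z).hasFDerivAt.fderiv
  rw [this, hzero, map_zero]

end IsWeakGradient

/-! ### Measurability, Young's inequality and admissible test functions -/

/-- A Carathéodory function composed with measurable functions is measurable. -/
theorem IsCaratheodory.aestronglyMeasurable_comp {A : Rn n → ℝ → Rn n → Rn n}
    (hA : IsCaratheodory A) {u : Rn n → ℝ} {G : Rn n → Rn n} (hu : AEMeasurable u volume)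
    (hG : AEMeasurable G volume) :
    AEStronglyMeasurable (fun x => A x (u x) (G x)) volume := by
  classical
  let d := TopologicalSpace.denseSeq (ℝ × Rn n)
  have hd : DenseRange d := TopologicalSpace.denseRange_denseSeq _
  have hm : ∀ k, AEMeasurable (fun x => A x (d k).1 (d k).2) volume := fun k => hA.measurable _ _
  -- The exceptional null set in the measurability hypothesis depends on `(t, ξ)`. A countable dense
  -- family needs only one null set `N`; after setting `A` to zero on `N`, continuity extends
  -- measurability to all `(t, ξ)`.
  let B : Set (Rn n) := {x | ∀ k, A x (d k).1 (d k).2 = (hm k).mk _ x}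
  have hB : ∀ᵐ x ∂volume, x ∈ B := ae_all_iff.2 fun k => (hm k).ae_eq_mk
  let N := toMeasurable volume Bᶜ
  have hNm : MeasurableSet N := measurableSet_toMeasurable _ _
  have hN : volume N = 0 := by rw [measure_toMeasurable]; exact hB
  let A' : ℝ × Rn n → Rn n → Rn n := fun z x => if x ∈ N then 0 else A x z.1 z.2
  have hcont : ∀ x, Continuous fun z => A' z x := by
    intro x
    by_cases hx : x ∈ N
    · simp only [A', hx, if_true]; exact continuous_const
    · simp only [A', hx, if_false]; exact hA.continuous x
  have hmeasd : ∀ k, Measurable (A' (d k)) := by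
    intro k
    have : A' (d k) = N.piecewise 0 ((hm k).mk _) := by
      ext1 x
      by_cases hx : x ∈ N
      · simp [A', hx]
      · have hxB : x ∈ B := by
          by_contra hc
          exact hx (subset_toMeasurable _ _ hc)
        simpa [A', hx] using hxB k
    rw [this]
    exact measurable_zero.piecewise hNm (hm k).measurable_mk
  have hmeas : ∀ z, Measurable (A' z) := by
    intro z
    obtain ⟨s, hs, hsz⟩ := mem_closure_iff_seq_limit.1 (hd z)
    choose j hj using hs
    refine measurable_of_tendsto_metrizable (f := fun i => A' (s i)) (fun i => ?_) ?_
    · rw [← hj i]; exact hmeasd _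
    · exact tendsto_pi_nhds.2 fun x => ((hcont x).tendsto z).comp hsz
  have hunc := measurable_uncurry_of_continuous_of_measurable hcont hmeas
  have hcomp : Measurable fun x => A' (hu.mk u x, hG.mk G x) x :=
    hunc.comp ((hu.measurable_mk.prodMk hG.measurable_mk).prodMk measurable_id)
  refine (hcomp.aestronglyMeasurable).congr ?_
  have hN' : ∀ᵐ x ∂volume, x ∉ N := by
    rw [ae_iff]; simpa using hN
  filter_upwards [hN', hu.ae_eq_mk, hG.ae_eq_mk] with x h1 h2 h3
  simp only [A', h1, if_false, ← h2, ← h3]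

/-- Young's inequality with non-optimal constants: compare `s` with `δ * t` and replace the smaller
one. -/
theorem rpow_sub_one_mul_le {s t r δ : ℝ} (hs : 0 ≤ s) (ht : 0 ≤ t) (hr : 1 < r) (hδ : 0 < δ) :
    s ^ (r - 1) * t ≤ δ⁻¹ * s ^ r + δ ^ (r - 1) * t ^ r := by
  have hmul : ∀ a : ℝ, 0 ≤ a → a ^ (r - 1) * a = a ^ r := fun a ha => by
    rw [← Real.rpow_add_one' ha (by linarith)]; congr 1; ring
  have h1 : 0 ≤ δ⁻¹ * s ^ r := by positivity
  have h2 : 0 ≤ δ ^ (r - 1) * t ^ r := by positivity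
  rcases le_total (δ * t) s with h | h
  · have : s ^ (r - 1) * t ≤ δ⁻¹ * s ^ r := by
      calc s ^ (r - 1) * t ≤ s ^ (r - 1) * (δ⁻¹ * s) := by
            gcongr
            rw [inv_mul_eq_div, le_div_iff₀ hδ]; linarith
        _ = δ⁻¹ * s ^ r := by rw [← hmul s hs]; ring
    linarith
  · have : s ^ (r - 1) * t ≤ δ ^ (r - 1) * t ^ r := by
      calc s ^ (r - 1) * t ≤ (δ * t) ^ (r - 1) * t := by
            gcongr
        _ = δ ^ (r - 1) * t ^ r := by
            rw [Real.mul_rpow hδ.le ht, ← hmul t ht]; ring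
    linarith

theorem IsLogHolderExponent.aestronglyMeasurable_rpow (hp : IsLogHolderExponent p)
    {F : Type*} [NormedAddCommGroup F] {f : Rn n → F} {μ : Measure (Rn n)}
    (hf : AEStronglyMeasurable f μ) : AEStronglyMeasurable (fun x => ‖f x‖ ^ p x) μ :=
  (hf.norm.aemeasurable.pow hp.continuous.aemeasurable).aestronglyMeasurable

/-- Since `p` is bounded, undoing the scaling by `μ` costs at most the factor `max 1 μ ^ P`. -/
theorem IsLogHolderExponent.integrableOn_of_memLpVar (hp : IsLogHolderExponent p)
    {F : Type*} [NormedAddCommGroup F] [NormedSpace ℝ F] {U : Set (Rn n)} {f : Rn n → F}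
    (hf : MemLpVar p U f) : IntegrableOn (fun x => ‖f x‖ ^ p x) U volume := by
  obtain ⟨P, hP⟩ := hp.bounded
  obtain ⟨hm, μ, hμ, hfin⟩ := hf
  have h1 : IntegrableOn (fun x => ‖μ⁻¹ • f x‖ ^ p x) U volume := by
    refine ⟨hp.aestronglyMeasurable_rpow (hm.const_smul μ⁻¹), ?_⟩
    rw [hasFiniteIntegral_iff_ofReal (Eventually.of_forall fun x => by positivity)]
    exact hfin
  refine (h1.const_mul (max 1 μ ^ P)).mono' (hp.aestronglyMeasurable_rpow hm)
    (Eventually.of_forall fun x => ?_)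
  have hpx := hp.one_lt x
  rw [Real.norm_of_nonneg (by positivity), norm_smul, Real.mul_rpow (by positivity) (by positivity),
    ← mul_assoc]
  refine le_mul_of_one_le_left (by positivity) ?_
  rw [norm_inv, Real.norm_of_nonneg hμ.le, Real.inv_rpow hμ.le]
  have h2 : μ ^ p x ≤ max 1 μ ^ P :=
    (Real.rpow_le_rpow hμ.le (le_max_right _ _) (by linarith)).trans
      (Real.rpow_le_rpow_of_exponent_le (le_max_left _ _) (hP x))
  rw [← div_eq_mul_inv, one_le_div (by positivity)]
  exact h2

theorem integrable_of_integrableOn_closedBall {F : Type*} [NormedAddCommGroup F] {f : Rn n → F}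
    {x₀ : Rn n} {r : ℝ} (hf : IntegrableOn f (Metric.closedBall x₀ r) volume)
    (h0 : ∀ x ∉ Metric.closedBall x₀ r, f x = 0) : Integrable f volume :=
  (integrableOn_iff_integrable_of_support_subset fun x hx => by
    by_contra hc; exact hx (h0 x hc)).1 hf

/-- Fields bounded by `B ‖G‖ ^ (p - 1)` annihilating the gradients of test functions also
annihilate compactly supported weak gradients of finite modular. -/
theorem IsLogHolderExponent.integral_inner_eq_zero (hp : IsLogHolderExponent p)
    {a G : Rn n → Rn n} {B : ℝ} (ha : AEStronglyMeasurable a volume)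
    (haG : ∀ x, ‖a x‖ ≤ B * ‖G x‖ ^ (p x - 1))
    (hG : ∀ r : ℝ, IntegrableOn (fun x => ‖G x‖ ^ p x) (Metric.closedBall 0 r) volume)
    (htest : ∀ φ : Rn n → ℝ, IsTestFunction φ → ∫ x, inner ℝ (a x) (gradient φ x) = 0)
    {v : Rn n → ℝ} {w : Rn n → Rn n} (hvw : IsWeakGradient v w) (hv : HasCompactSupport v)
    (hw : HasCompactSupport w) (hwp : Integrable (fun x => ‖w x‖ ^ p x) volume) :
    ∫ x, inner ℝ (a x) (w x) = 0 := by
  wlog hB : 0 ≤ B generalizing B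
  · refine this (B := 0) (fun x => ?_) le_rfl
    refine (haG x).trans ?_
    gcongr
    linarith
  obtain ⟨C, hC, hCb⟩ :=
    hp.exists_norm_convolution_rpow_le hvw.locallyIntegrable_grad hwp
  let φ : ℕ → ContDiffBump (0 : Rn n) := fun k =>
    ⟨1 / (k + 1) / 2, 1 / (k + 1), by positivity, half_lt_self (by positivity)⟩
  have hφ : Tendsto (fun k => (φ k).rOut) atTop (𝓝 0) :=
    tendsto_one_div_add_atTop_nhds_zero_nat
  have hφ1 : ∀ k, (φ k).rOut ≤ 1 := fun k => by
    change 1 / ((k : ℝ) + 1) ≤ 1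
    rw [div_le_one (by positivity)]
    have : (0 : ℝ) ≤ k := by positivity
    linarith
  have hφ2 : ∀ k, (φ k).rOut ≤ 2 * (φ k).rIn := fun k => by
    change 1 / ((k : ℝ) + 1) ≤ 2 * (1 / ((k : ℝ) + 1) / 2)
    linarith
  let ρ : ℕ → Rn n → ℝ := fun k => (φ k).normed volume
  let wk : ℕ → Rn n → Rn n := fun k => ρ k ⋆[ContinuousLinearMap.lsmul ℝ ℝ, volume] w
  let g : Rn n → ℝ := fun x => ‖w x‖ ^ p x
  let gk : ℕ → Rn n → ℝ := fun k => ρ k ⋆[ContinuousLinearMap.lsmul ℝ ℝ, volume] g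
  obtain ⟨r, hr⟩ := hw.isCompact.isBounded.subset_closedBall (0 : Rn n)
  have hw0 : ∀ x ∉ Metric.closedBall (0 : Rn n) (r + 1), w x = 0 := fun x hx => by
    by_contra hc
    exact hx (Metric.closedBall_subset_closedBall (by linarith) (hr (subset_tsupport _ hc)))
  have hwk0 : ∀ k, ∀ x ∉ Metric.closedBall (0 : Rn n) (r + 1), wk k x = 0 := by
    intro k x hx
    by_contra hc
    obtain ⟨y, hy, z, hz, rfl⟩ := Set.mem_add.1
      (support_convolution_subset (ContinuousLinearMap.lsmul ℝ ℝ) hc)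
    rw [(φ k).support_normed_eq] at hy
    have h1 := hr (subset_tsupport _ hz)
    apply hx
    rw [mem_closedBall_zero_iff] at h1 ⊢
    rw [mem_ball_zero_iff] at hy
    have := hφ1 k
    linarith [norm_add_le y z]
  have hgk_int : ∀ k, Integrable (gk k) volume := fun k =>
    ((φ k).integrable_normed).integrable_convolution _ hwp
  let Q : Rn n → ℝ := (Metric.closedBall (0 : Rn n) (r + 1)).indicator
    fun x => B * (‖G x‖ ^ p x + C)
  have hQ : Integrable Q volume := by
    rw [integrable_indicator_iff Metric.isClosed_closedBall.measurableSet]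
    refine ((hG (r + 1)).add ?_).const_mul B
    exact integrableOn_const measure_closedBall_lt_top.ne
  have hzero : ∀ k, ∫ x, inner ℝ (a x) (wk k x) = 0 := by
    intro k
    have hρ := IsTestFunction.normed (φ k)
    have ht : IsTestFunction (ρ k ⋆[ContinuousLinearMap.lsmul ℝ ℝ, volume] v) :=
      ⟨hρ.2.contDiff_convolution_left _ hρ.1 hvw.locallyIntegrable, hρ.2.convolution _ hv⟩
    rw [← htest _ ht, gradient_eq fun x => hvw.hasGradientAt_convolution hρ x]
  have hlim : Tendsto (fun k => ∫ x, inner ℝ (a x) (wk k x)) atTop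
      (𝓝 (∫ x, inner ℝ (a x) (w x))) := by
    -- No fixed dominating function is at hand; the dominants involve the mollified modular `gk k`,
    -- which converges almost everywhere and has the same integral as `g`.
    refine tendsto_integral_of_tendsto_bound (H := fun k x => Q x + B * C * gk k x)
      (h := fun x => Q x + B * C * g x) (fun k => ?_) (fun k => ?_) ?_ (fun k => ?_) ?_ ?_ ?_
    · refine ha.inner (Continuous.aestronglyMeasurable ?_)
      exact (φ k).hasCompactSupport_normed.continuous_convolution_left _
        (φ k).continuous_normed hvw.locallyIntegrable_grad
    · exact hQ.add ((hgk_int k).const_mul _)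
    · exact hQ.add (hwp.const_mul _)
    · refine Eventually.of_forall fun x => ?_
      by_cases hx : x ∈ Metric.closedBall (0 : Rn n) (r + 1)
      · have h1 := hCb (φ k) (hφ1 k) (hφ2 k) x
        change ‖wk k x‖ ^ p x ≤ C * (1 + gk k x) at h1
        have h2 := rpow_sub_one_mul_le (norm_nonneg (G x)) (norm_nonneg (wk k x)) (hp.one_lt x)
          one_pos
        simp only [inv_one, one_mul, Real.one_rpow] at h2
        calc |inner ℝ (a x) (wk k x)| ≤ ‖a x‖ * ‖wk k x‖ := abs_real_inner_le_norm _ _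
          _ ≤ B * ‖G x‖ ^ (p x - 1) * ‖wk k x‖ := by gcongr; exact haG x
          _ = B * (‖G x‖ ^ (p x - 1) * ‖wk k x‖) := by ring
          _ ≤ B * (‖G x‖ ^ p x + C * (1 + gk k x)) := by
              gcongr
              linarith
          _ = Q x + B * C * gk k x := by
              simp only [Q, Set.indicator_of_mem hx]
              ring
      · rw [hwk0 k x hx, inner_zero_right, abs_zero]
        simp only [Q, Set.indicator_of_notMem hx, zero_add]
        have : 0 ≤ gk k x := by
          change 0 ≤ (ρ k ⋆[ContinuousLinearMap.lsmul ℝ ℝ, volume] g) x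
          rw [convolution_lsmul]
          exact integral_nonneg fun t => mul_nonneg ((φ k).nonneg_normed t)
            (Real.rpow_nonneg (norm_nonneg _) _)
        positivity
    · filter_upwards [ContDiffBump.ae_convolution_tendsto_right_of_locallyIntegrable hφ
        (Eventually.of_forall hφ2) hvw.locallyIntegrable_grad] with x hx
      exact tendsto_const_nhds.inner hx
    · filter_upwards [ContDiffBump.ae_convolution_tendsto_right_of_locallyIntegrable hφ
        (Eventually.of_forall hφ2) hwp.locallyIntegrable] with x hx
      exact tendsto_const_nhds.add (hx.const_mul _)
    · refine tendsto_const_nhds.congr fun k => ?_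
      rw [integral_add hQ (hwp.const_mul _), integral_add hQ ((hgk_int k).const_mul _),
        integral_const_mul, integral_const_mul]
      congr 2
      have := integral_convolution (ContinuousLinearMap.lsmul ℝ ℝ)
        ((φ k).integrable_normed (μ := volume)) hwp
      rw [(φ k).integral_normed] at this
      simpa using this.symm
  simp_rw [hzero] at hlim
  exact (tendsto_nhds_unique hlim tendsto_const_nhds)

/-! ### Cutoffs and the Caccioppoli estimate -/

/-- Smooth cutoff functions between concentric balls of radii `R` and `2R`. -/
theorem exists_cutoff (n : ℕ) : ∃ c : ℝ, 0 ≤ c ∧ ∀ (x₀ : Rn n) (R : ℝ), 0 < R →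
    ∃ η : Rn n → ℝ, IsTestFunction η ∧ (∀ x, 0 ≤ η x) ∧ (∀ x, η x ≤ 1) ∧
      (∀ x ∈ Metric.ball x₀ R, η x = 1) ∧ (∀ x ∉ Metric.ball x₀ (2 * R), η x = 0) ∧
      (∀ x ∈ Metric.ball x₀ R, gradient η x = 0) ∧ ∀ x, ‖gradient η x‖ ≤ c / R := by
  let β : ContDiffBump (0 : Rn n) := ⟨1, 2, one_pos, one_lt_two⟩
  have hβ : IsTestFunction (β : Rn n → ℝ) := ⟨β.contDiff, β.hasCompactSupport⟩
  obtain ⟨c, hc⟩ := hβ.hasCompactSupport_gradient.exists_bound_of_continuous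
    hβ.continuous_gradient
  refine ⟨c, (norm_nonneg _).trans (hc 0), fun x₀ R hR => ?_⟩
  have hdist : ∀ x, dist (R⁻¹ • (x - x₀)) 0 = R⁻¹ * dist x x₀ := fun x => by
    rw [dist_zero_right, norm_smul, norm_inv, Real.norm_of_nonneg hR.le, dist_eq_norm]
  have hone : ∀ x ∈ Metric.ball x₀ R, β (R⁻¹ • (x - x₀)) = 1 := fun x hx =>
    β.one_of_mem_closedBall (by
      rw [Metric.mem_closedBall, hdist, inv_mul_le_iff₀ hR]
      change dist x x₀ ≤ R * 1
      linarith [Metric.mem_ball.1 hx])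
  have hz : ∀ x ∉ Metric.ball x₀ (2 * R), β (R⁻¹ • (x - x₀)) = 0 := fun x hx =>
    β.zero_of_le_dist (by
      rw [hdist, le_inv_mul_iff₀ hR]
      change R * 2 ≤ _
      rw [Metric.mem_ball, not_lt] at hx
      linarith)
  refine ⟨fun x => β (R⁻¹ • (x - x₀)), ⟨?_, ?_⟩, fun x => β.nonneg, fun x => β.le_one, hone, hz,
    ?_, ?_⟩
  · exact hβ.1.comp ((contDiff_id.sub contDiff_const).const_smul R⁻¹)
  · exact HasCompactSupport.intro (isCompact_closedBall x₀ (2 * R)) fun x hx =>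
      hz x fun h => hx (Metric.ball_subset_closedBall h)
  · intro x hx
    have : (fun x => β (R⁻¹ • (x - x₀))) =ᶠ[𝓝 x] fun _ => (1 : ℝ) := by
      filter_upwards [Metric.isOpen_ball.mem_nhds hx] with y hy using hone y hy
    rw [this.gradient_eq, gradient_fun_const]
  · intro x
    have h1 : HasFDerivAt (fun x : Rn n => R⁻¹ • (x - x₀))
        (R⁻¹ • ContinuousLinearMap.id ℝ (Rn n)) x :=
      ((hasFDerivAt_id x).sub_const x₀).const_smul R⁻¹
    have h2 := (hβ.differentiableAt (R⁻¹ • (x - x₀))).hasGradientAt.hasFDerivAt.comp x h1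
    have h3 : HasGradientAt (fun x => β (R⁻¹ • (x - x₀)))
        (R⁻¹ • gradient β (R⁻¹ • (x - x₀))) x := by
      rw [hasGradientAt_iff_hasFDerivAt]
      convert! h2 using 1
      ext y
      simp
    rw [h3.gradient, norm_smul, norm_inv, Real.norm_of_nonneg hR.le, div_eq_inv_mul]
    gcongr
    exact hc _

theorem add_rpow_le_two_rpow_mul {s t r : ℝ} (hs : 0 ≤ s) (ht : 0 ≤ t) (hr : 0 ≤ r) :
    (s + t) ^ r ≤ 2 ^ r * (s ^ r + t ^ r) := by
  have hs' : 0 ≤ s ^ r := by positivity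
  have ht' : 0 ≤ t ^ r := by positivity
  calc (s + t) ^ r ≤ (2 * max s t) ^ r := by
        gcongr
        linarith [le_max_left s t, le_max_right s t]
    _ = 2 ^ r * max s t ^ r := Real.mul_rpow (by norm_num) (le_max_of_le_left hs)
    _ ≤ 2 ^ r * (s ^ r + t ^ r) := by
        gcongr
        rcases max_choice s t with h | h <;> rw [h] <;> linarith

/-- For `e ≤ 1` and `m ≥ q` one has `m (q-1)/q ≤ m - 1`, so `e^(m-1)` can be merged into the power
`q - 1` of `s`. Young's inequality then returns the full weight `e^m` in front of `s^q`, which makes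
absorption possible. -/
theorem pow_pred_mul_rpow_mul_le {e s t q δ : ℝ} {m : ℕ} (he : 0 ≤ e) (he1 : e ≤ 1) (hs : 0 ≤ s)
    (ht : 0 ≤ t) (hq : 1 < q) (hm : 2 ≤ m) (hqm : q ≤ m) (hδ : 0 < δ) :
    e ^ (m - 1) * s ^ (q - 1) * t ≤ δ⁻¹ * (e ^ m * s ^ q) + δ ^ (q - 1) * t ^ q := by
  have hq0 : 0 < q := by linarith
  have h1 : e ^ (m - 1) ≤ (e ^ (m / q : ℝ)) ^ (q - 1) := by
    rcases he.eq_or_lt with rfl | he'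
    · rw [zero_pow (by omega)]; positivity
    · rw [← Real.rpow_mul he, ← Real.rpow_natCast, Nat.cast_sub (by omega), Nat.cast_one]
      refine Real.rpow_le_rpow_of_exponent_ge he' he1 ?_
      rw [div_mul_eq_mul_div, div_le_iff₀ hq0]
      nlinarith
  have h2 : (e ^ (m / q : ℝ)) ^ q = e ^ m := by
    rw [← Real.rpow_mul he, div_mul_cancel₀ _ hq0.ne', Real.rpow_natCast]
  have he' : 0 ≤ e ^ (m / q : ℝ) := by positivity
  calc e ^ (m - 1) * s ^ (q - 1) * t ≤ (e ^ (m / q : ℝ)) ^ (q - 1) * s ^ (q - 1) * t := by gcongr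
    _ = (e ^ (m / q : ℝ) * s) ^ (q - 1) * t := by rw [Real.mul_rpow he' hs]
    _ ≤ δ⁻¹ * (e ^ (m / q : ℝ) * s) ^ q + δ ^ (q - 1) * t ^ q :=
        rpow_sub_one_mul_le (by positivity) ht hq hδ
    _ = _ := by rw [Real.mul_rpow he' hs, h2]

theorem MemW1pLoc.integrableOn_closedBall {u : Rn n → ℝ} {G : Rn n → Rn n}
    (hp : IsLogHolderExponent p) (h : MemW1pLoc p u G) (x₀ : Rn n) (r : ℝ) :
    IntegrableOn (fun x => ‖G x‖ ^ p x) (Metric.closedBall x₀ r) volume :=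
  (hp.integrableOn_of_memLpVar (h.memLp_grad (Metric.ball x₀ (r + 1)) Metric.isOpen_ball
    Metric.isBounded_ball)).mono_set (Metric.closedBall_subset_ball (by linarith))

/-- Caccioppoli type estimate for bounded `A`-harmonic functions, with a parameter `δ`. -/
theorem exists_caccioppoli (hp : IsLogHolderExponent p) {A : Rn n → ℝ → Rn n → Rn n}
    (hA : HasNonstandardGrowth p A) {q : ℝ} (hq1 : 1 < q) (hq : (n : ℝ) ≤ q)
    {u : Rn n → ℝ} {G : Rn n → Rn n} (hu : Continuous u) (huG : MemW1pLoc p u G)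
    (htest : ∀ φ : Rn n → ℝ, IsTestFunction φ →
      ∫ x, inner ℝ (A x (u x) (G x)) (gradient φ x) = 0)
    {M : ℝ} (hM : ∀ x, |u x| ≤ M) :
    ∃ K : ℝ, 0 ≤ K ∧ ∀ (x₀ : Rn n) (R : ℝ), 1 ≤ R →
      (∀ x ∈ Metric.ball x₀ (2 * R) \ Metric.ball x₀ R, p x = q) →
      ∃ ζ : Rn n → ℝ, Integrable (fun x => ζ x * ‖G x‖ ^ p x) volume ∧
        (∀ x, 0 ≤ ζ x) ∧ (∀ x, ζ x ≤ 1) ∧ (∀ x ∈ Metric.ball x₀ R, ζ x = 1) ∧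
        ∀ δ : ℝ, 0 < δ → ∫ x, ζ x * ‖G x‖ ^ p x ≤
          K * (δ⁻¹ * (∫ x in Metric.ball x₀ (2 * R) \ Metric.ball x₀ R, ζ x * ‖G x‖ ^ p x)
            + δ ^ (q - 1)) := by
  obtain ⟨P, hP⟩ := hp.bounded
  obtain ⟨a₁, b, -, -, ⟨am, ham, hama⟩, hab, ⟨B, hbB⟩, hlow, hupp⟩ := hA.growth
  obtain ⟨c, hc, hcut⟩ := exists_cutoff n
  have hM0 : 0 ≤ M := (abs_nonneg _).trans (hM 0)
  have hB0 : 0 ≤ B := by linarith [hama 0, hab 0, hbB 0]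
  let a : Rn n → Rn n := fun x => A x (u x) (G x)
  have hGm : AEStronglyMeasurable G volume :=
    huG.weakGradient.locallyIntegrable_grad.aestronglyMeasurable
  have ha : AEStronglyMeasurable a volume :=
    hA.caratheodory.aestronglyMeasurable_comp hu.measurable.aemeasurable hGm.aemeasurable
  have haG : ∀ x, ‖a x‖ ≤ B * ‖G x‖ ^ (p x - 1) := fun x =>
    (hupp x (u x) (G x)).trans (by gcongr; exact hbB x)
  -- `m ≥ q` serves the weighted Young inequality, and `m ≥ 2` makes `η^(m-1)` vanish wherever `η`
  -- does.
  obtain ⟨m, hm2, hqm⟩ : ∃ m : ℕ, 2 ≤ m ∧ q ≤ m :=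
    ⟨max 2 ⌈q⌉₊, le_max_left _ _, (Nat.le_ceil q).trans (by exact_mod_cast le_max_right _ _)⟩
  set V := volume.real (Metric.closedBall (0 : Rn n) 1) with hV
  have hV0 : 0 ≤ V := measureReal_nonneg
  refine ⟨M * B * m / am * max 1 (c ^ q * 2 ^ n * V), by positivity, fun x₀ R hR hpq => ?_⟩
  have hR0 : 0 < R := by linarith
  obtain ⟨η, hη, hη0, hη1, hηone, hηzero, hηgrad, hηc⟩ := hcut x₀ R hR0
  have hζ := hη.pow (s := m) (by omega)
  let S := Metric.closedBall x₀ (2 * R)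
  let N := Metric.ball x₀ (2 * R) \ Metric.ball x₀ R
  let ζ : Rn n → ℝ := fun x => η x ^ m
  let g : Rn n → ℝ := fun x => ‖G x‖ ^ p x
  have hg0 : ∀ x, 0 ≤ g x := fun x => by positivity
  have hζ0 : ∀ x, 0 ≤ ζ x := fun x => pow_nonneg (hη0 x) m
  have hζ1 : ∀ x, ζ x ≤ 1 := fun x => pow_le_one₀ (hη0 x) (hη1 x)
  have hζgrad : ∀ x, gradient ζ x = (m * η x ^ (m - 1)) • gradient η x := hη.gradient_pow m
  have hηS : ∀ x ∉ S, η x = 0 := fun x hx => hηzero x fun h => hx (Metric.ball_subset_closedBall h)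
  have hζS : ∀ x ∉ S, ζ x = 0 := fun x hx => by
    simp only [ζ, hηS x hx, zero_pow (show m ≠ 0 by omega)]
  have hζgradS : ∀ x ∉ S, gradient ζ x = 0 := fun x hx => by
    rw [hζgrad, hηS x hx, zero_pow (show m - 1 ≠ 0 by omega), mul_zero, zero_smul]
  have hζnorm : ∀ x, ‖gradient ζ x‖ = m * η x ^ (m - 1) * ‖gradient η x‖ := fun x => by
    rw [hζgrad, norm_smul, Real.norm_of_nonneg (mul_nonneg (by positivity) (pow_nonneg (hη0 x) _))]
  have hgS : IntegrableOn g S volume := huG.integrableOn_closedBall hp x₀ (2 * R)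
  have hgm : AEStronglyMeasurable g volume := hp.aestronglyMeasurable_rpow hGm
  have hζg : Integrable (fun x => ζ x * g x) volume := by
    refine integrable_of_integrableOn_closedBall (x₀ := x₀) (r := 2 * R) ?_
      fun x hx => by rw [hζS x hx, zero_mul]
    refine hgS.mono' (hζ.continuous.aestronglyMeasurable.mul hgm).restrict
      (Eventually.of_forall fun x => ?_)
    rw [Real.norm_of_nonneg (mul_nonneg (hζ0 x) (hg0 x))]
    exact mul_le_of_le_one_left (hg0 x) (hζ1 x)
  have hvw := huG.weakGradient.mul_testFunction hζ
  have hwS : ∀ x ∉ S, η x ^ m • G x + u x • gradient ζ x = 0 := fun x hx => by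
    have := hζS x hx
    simp only [ζ] at this
    rw [this, hζgradS x hx, zero_smul, smul_zero, add_zero]
  have hwp : Integrable (fun x => ‖η x ^ m • G x + u x • gradient ζ x‖ ^ p x) volume := by
    refine integrable_of_integrableOn_closedBall (x₀ := x₀) (r := 2 * R) ?_ fun x hx => by
      rw [hwS x hx, norm_zero, Real.zero_rpow (by linarith [hp.one_lt x])]
    set E := max 1 (M * (m * (c / R))) with hE
    have hE1 : 1 ≤ E := le_max_left _ _
    have hdom : IntegrableOn (fun x => 2 ^ P * (g x + E ^ P)) S volume :=
      (hgS.add (integrableOn_const measure_closedBall_lt_top.ne)).const_mul _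
    refine hdom.mono' (hp.aestronglyMeasurable_rpow
      hvw.locallyIntegrable_grad.aestronglyMeasurable.restrict) (Eventually.of_forall fun x => ?_)
    have hp1 := hp.one_lt x
    rw [Real.norm_of_nonneg (by positivity)]
    have h1 : ‖η x ^ m • G x + u x • gradient ζ x‖ ≤ ‖G x‖ + E := by
      refine (norm_add_le _ _).trans (add_le_add ?_ ?_)
      · rw [norm_smul, Real.norm_of_nonneg (hζ0 x)]
        exact mul_le_of_le_one_left (norm_nonneg _) (hζ1 x)
      · rw [norm_smul, hζnorm, Real.norm_eq_abs]
        refine le_trans ?_ (le_max_right _ _)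
        have h2 : (m : ℝ) * η x ^ (m - 1) ≤ m :=
          mul_le_of_le_one_right (by positivity) (pow_le_one₀ (hη0 x) (hη1 x))
        exact mul_le_mul (hM x) (mul_le_mul h2 (hηc x) (norm_nonneg _) (by positivity))
          (mul_nonneg (mul_nonneg (by positivity) (pow_nonneg (hη0 x) _)) (norm_nonneg _)) hM0
    calc _ ≤ (‖G x‖ + E) ^ p x := Real.rpow_le_rpow (norm_nonneg _) h1 (by linarith)
      _ ≤ 2 ^ p x * (‖G x‖ ^ p x + E ^ p x) :=
          add_rpow_le_two_rpow_mul (norm_nonneg _) (by linarith) (by linarith)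
      _ ≤ 2 ^ P * (g x + E ^ P) := by
          have := hP x
          gcongr
          norm_num
  -- The equation tested with `ζ u`, whose weak gradient is `ζ ∇u + u ∇ζ`.
  have hzero : ∫ x, inner ℝ (a x) (η x ^ m • G x + u x • gradient ζ x) = 0 :=
    hp.integral_inner_eq_zero ha haG (fun r => huG.integrableOn_closedBall hp 0 r) htest hvw
      hζ.2.mul_right (HasCompactSupport.intro (isCompact_closedBall x₀ (2 * R)) hwS) hwp
  refine ⟨ζ, hζg, hζ0, hζ1, fun x hx => by simp only [ζ, hηone x hx, one_pow], fun δ hδ => ?_⟩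
  have hNm : MeasurableSet N := measurableSet_ball.diff measurableSet_ball
  let T : Rn n → ℝ := fun x => m * (δ⁻¹ * N.indicator (fun y => ζ y * g y) x
    + δ ^ (q - 1) * S.indicator (fun _ => (c / R) ^ q) x)
  have hi1 : Integrable (N.indicator fun y => ζ y * g y) volume := hζg.indicator hNm
  have hi2 : Integrable (S.indicator fun _ => (c / R) ^ q) volume := by
    rw [integrable_indicator_iff Metric.isClosed_closedBall.measurableSet]
    exact integrableOn_const measure_closedBall_lt_top.ne
  have hTint : Integrable T volume :=
    ((hi1.const_mul _).add (hi2.const_mul _)).const_mul _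
  have hTnn : ∀ x, 0 ≤ T x := fun x => by
    have h1 : 0 ≤ N.indicator (fun y => ζ y * g y) x :=
      Set.indicator_nonneg (fun y _ => mul_nonneg (hζ0 y) (hg0 y)) x
    have h2 : 0 ≤ S.indicator (fun _ => (c / R) ^ q) x :=
      Set.indicator_nonneg (fun y _ => by positivity) x
    positivity
  -- The gradient of `ζ` vanishes off the annulus `N`, so Young's inequality is needed only with the
  -- constant exponent `q`.
  have hT : ∀ x, ‖G x‖ ^ (p x - 1) * ‖gradient ζ x‖ ≤ T x := by
    intro x
    by_cases hx : x ∈ N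
    · have hxS : x ∈ S := Metric.ball_subset_closedBall hx.1
      simp only [T, Set.indicator_of_mem hx, Set.indicator_of_mem hxS, ζ, g]
      rw [hζnorm, hpq x hx]
      have h1 := pow_pred_mul_rpow_mul_le (hη0 x) (hη1 x) (norm_nonneg (G x))
        (norm_nonneg (gradient η x)) hq1 hm2 hqm hδ
      have h2 : ‖gradient η x‖ ^ q ≤ (c / R) ^ q := by
        gcongr
        exact hηc x
      calc _ = m * (η x ^ (m - 1) * ‖G x‖ ^ (q - 1) * ‖gradient η x‖) := by ring
        _ ≤ m * (δ⁻¹ * (η x ^ m * ‖G x‖ ^ q) + δ ^ (q - 1) * (c / R) ^ q) := by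
          gcongr
          exact h1.trans (by gcongr)
    · have h1 : gradient ζ x = 0 := by
        rw [hζgrad]
        by_cases hx2 : x ∈ Metric.ball x₀ (2 * R)
        · have hx1 : x ∈ Metric.ball x₀ R := by
            by_contra hc'
            exact hx ⟨hx2, hc'⟩
          rw [hηgrad x hx1, smul_zero]
        · rw [hηzero x hx2, zero_pow (show m - 1 ≠ 0 by omega), mul_zero, zero_smul]
      rw [h1, norm_zero, mul_zero]
      exact hTnn x
  have hi3 : Integrable (fun x => ζ x * inner ℝ (a x) (G x)) volume := by
    refine (hζg.const_mul B).mono' (hζ.continuous.aestronglyMeasurable.mul (ha.inner hGm))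
      (Eventually.of_forall fun x => ?_)
    rw [norm_mul, Real.norm_of_nonneg (hζ0 x)]
    have h1 : ‖inner ℝ (a x) (G x)‖ ≤ B * g x := by
      refine (norm_inner_le_norm _ _).trans ?_
      calc ‖a x‖ * ‖G x‖ ≤ B * ‖G x‖ ^ (p x - 1) * ‖G x‖ := by gcongr; exact haG x
        _ = B * g x := by
          have hp1 := hp.one_lt x
          rw [mul_assoc, ← Real.rpow_add_one' (norm_nonneg _) (by linarith), sub_add_cancel]
    calc _ ≤ ζ x * (B * g x) := mul_le_mul_of_nonneg_left h1 (hζ0 x)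
      _ = _ := by ring
  have hb4 : ∀ x, ‖u x * inner ℝ (a x) (gradient ζ x)‖ ≤ M * B * T x := fun x => by
    rw [norm_mul, Real.norm_eq_abs]
    calc |u x| * ‖inner ℝ (a x) (gradient ζ x)‖
        ≤ M * (B * ‖G x‖ ^ (p x - 1) * ‖gradient ζ x‖) := by
          refine mul_le_mul (hM x) ((norm_inner_le_norm _ _).trans ?_) (norm_nonneg _) hM0
          gcongr
          exact haG x
      _ = M * B * (‖G x‖ ^ (p x - 1) * ‖gradient ζ x‖) := by ring
      _ ≤ _ := by
          gcongr
          exact hT x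
  have hi4 : Integrable (fun x => u x * inner ℝ (a x) (gradient ζ x)) volume :=
    (hTint.const_mul (M * B)).mono' (hu.aestronglyMeasurable.mul
      (ha.inner hζ.continuous_gradient.aestronglyMeasurable)) (Eventually.of_forall hb4)
  have hsum : (∫ x, ζ x * inner ℝ (a x) (G x)) +
      ∫ x, u x * inner ℝ (a x) (gradient ζ x) = 0 := by
    rw [← integral_add hi3 hi4, ← hzero]
    refine integral_congr_ae (Eventually.of_forall fun x => ?_)
    simp only [inner_add_right, real_inner_smul_right, ζ]
  have hlower : am * ∫ x, ζ x * g x ≤ ∫ x, ζ x * inner ℝ (a x) (G x) := by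
    rw [← integral_const_mul]
    refine integral_mono (hζg.const_mul am) hi3 fun x => ?_
    have h1 : am * g x ≤ inner ℝ (a x) (G x) :=
      (mul_le_mul_of_nonneg_right (hama x) (hg0 x)).trans (hlow x (u x) (G x))
    have := mul_le_mul_of_nonneg_left h1 (hζ0 x)
    simp only
    linarith
  have hupper : -∫ x, u x * inner ℝ (a x) (gradient ζ x) ≤ M * B * ∫ x, T x := by
    rw [← integral_const_mul]
    refine (neg_le_abs _).trans ?_
    exact norm_integral_le_of_norm_le (hTint.const_mul (M * B)) (Eventually.of_forall hb4)
  have hTeq : ∫ x, T x = m * (δ⁻¹ * (∫ x in N, ζ x * g x)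
      + δ ^ (q - 1) * ((c / R) ^ q * volume.real S)) := by
    simp only [T]
    rw [integral_const_mul, integral_add (hi1.const_mul _) (hi2.const_mul _), integral_const_mul,
      integral_const_mul, integral_indicator hNm,
      integral_indicator Metric.isClosed_closedBall.measurableSet, setIntegral_const, smul_eq_mul,
      mul_comm ((c / R) ^ q)]
  -- The scaling condition: `R^(n-q) ≤ 1` because `q ≥ n` and `R ≥ 1`.
  have hvol : (c / R) ^ q * volume.real S ≤ c ^ q * 2 ^ n * V := by
    have h1 : volume.real S = (2 * R) ^ n * V := by
      have := Measure.addHaar_real_closedBall' (volume : Measure (Rn n)) x₀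
        (show 0 ≤ 2 * R by positivity)
      simpa using this
    have h2 : R ^ n ≤ R ^ q := by
      rw [← Real.rpow_natCast]
      exact Real.rpow_le_rpow_of_exponent_le hR hq
    rw [h1, Real.div_rpow hc hR0.le, mul_pow]
    have h3 : 0 < R ^ q := by positivity
    rw [div_mul_eq_mul_div, div_le_iff₀ h3]
    calc c ^ q * (2 ^ n * R ^ n * V) = c ^ q * 2 ^ n * V * R ^ n := by ring
      _ ≤ _ := by gcongr
  set J := ∫ x in N, ζ x * g x with hJ
  have hJ0 : 0 ≤ J := integral_nonneg fun x => mul_nonneg (hζ0 x) (hg0 x)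
  have hδq : 0 ≤ δ ^ (q - 1) := by positivity
  set D := max 1 (c ^ q * 2 ^ n * V)
  have hD1 : 1 ≤ D := le_max_left _ _
  have hfin : am * ∫ x, ζ x * g x ≤ M * B * m * (D * (δ⁻¹ * J + δ ^ (q - 1))) := by
    calc am * ∫ x, ζ x * g x ≤ M * B * ∫ x, T x := by linarith
      _ = M * B * m * (δ⁻¹ * J + δ ^ (q - 1) * ((c / R) ^ q * volume.real S)) := by
          rw [hTeq]; ring
      _ ≤ M * B * m * (D * (δ⁻¹ * J) + δ ^ (q - 1) * D) := by
          have h1 : δ⁻¹ * J ≤ D * (δ⁻¹ * J) := le_mul_of_one_le_left (by positivity) hD1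
          have h2 : (c / R) ^ q * volume.real S ≤ D := hvol.trans (le_max_right _ _)
          gcongr
      _ = _ := by ring
  change ∫ x, ζ x * g x ≤ M * B * m / am * D * (δ⁻¹ * J + δ ^ (q - 1))
  rw [div_mul_eq_mul_div, div_mul_eq_mul_div, le_div_iff₀ ham]
  linarith

/-! ### From the Caccioppoli estimate to the Liouville theorem -/

/-- Absorption with one large `δ` gives global integrability; then the annulus term is dominated by
a tail of a convergent integral, and only `K δ^(q-1)` survives, which vanishes as `δ → 0` because `q
> 1`. -/
theorem ae_eq_zero_of_caccioppoli {g : Rn n → ℝ} (hg0 : ∀ x, 0 ≤ g x) {x₀ : Rn n} {R : ℕ → ℝ}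
    (hg : ∀ r, IntegrableOn g (Metric.closedBall x₀ r) volume) (hR : Tendsto R atTop atTop)
    {K q : ℝ} (hK : 0 ≤ K) (hq : 1 < q)
    (h : ∀ᶠ k in atTop, ∃ ζ : Rn n → ℝ, Integrable (fun x => ζ x * g x) volume ∧
      (∀ x, 0 ≤ ζ x) ∧ (∀ x, ζ x ≤ 1) ∧ (∀ x ∈ Metric.ball x₀ (R k), ζ x = 1) ∧
      ∀ δ : ℝ, 0 < δ → ∫ x, ζ x * g x ≤ K * (δ⁻¹ *
        (∫ x in Metric.ball x₀ (2 * R k) \ Metric.ball x₀ (R k), ζ x * g x) + δ ^ (q - 1))) :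
    g =ᵐ[volume] 0 := by
  have hball : ∀ r, IntegrableOn g (Metric.ball x₀ r) volume := fun r =>
    (hg r).mono_set Metric.ball_subset_closedBall
  have hcover : AECover volume atTop fun k => Metric.ball x₀ (R k) := aecover_ball hR
  have hle : ∀ k, ∀ ζ : Rn n → ℝ, Integrable (fun x => ζ x * g x) volume → (∀ x, 0 ≤ ζ x) →
      (∀ x ∈ Metric.ball x₀ (R k), ζ x = 1) →
      ∫ x in Metric.ball x₀ (R k), g x ≤ ∫ x, ζ x * g x := by
    intro k ζ h1 h2 h3
    calc ∫ x in Metric.ball x₀ (R k), g x = ∫ x in Metric.ball x₀ (R k), ζ x * g x :=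
          setIntegral_congr_fun measurableSet_ball fun x hx => by simp only [h3 x hx, one_mul]
      _ ≤ _ := setIntegral_le_integral h1
          (Eventually.of_forall fun x => mul_nonneg (h2 x) (hg0 x))
  have hint : Integrable g volume := by
    refine hcover.integrable_of_integral_norm_bounded
      (2 * (K * (2 * K + 1) ^ (q - 1))) (fun k => hball _) ?_
    filter_upwards [h] with k hk
    obtain ⟨ζ, h1, h2, h3, h4, h5⟩ := hk
    -- This `δ` gives `K/δ ≤ 1/2`, so half of `∫ ζ g`, already known to be finite, is absorbed on
    -- the left.
    have h6 := h5 (2 * K + 1) (by positivity)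
    have h7 : ∫ x in Metric.ball x₀ (2 * R k) \ Metric.ball x₀ (R k), ζ x * g x
        ≤ ∫ x, ζ x * g x :=
      setIntegral_le_integral h1 (Eventually.of_forall fun x => mul_nonneg (h2 x) (hg0 x))
    have h8 : 0 ≤ ∫ x, ζ x * g x := integral_nonneg fun x => mul_nonneg (h2 x) (hg0 x)
    have h9 : K * (2 * K + 1)⁻¹ ≤ 1 / 2 := by
      rw [← div_eq_mul_inv, div_le_div_iff₀ (by positivity) (by norm_num)]
      linarith
    simp_rw [Real.norm_of_nonneg (hg0 _)]
    have h10 := hle k ζ h1 h2 h4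
    have h11 : K * ((2 * K + 1)⁻¹ *
        ∫ x in Metric.ball x₀ (2 * R k) \ Metric.ball x₀ (R k), ζ x * g x)
        ≤ 1 / 2 * ∫ x, ζ x * g x := by
      calc _ ≤ K * ((2 * K + 1)⁻¹ * ∫ x, ζ x * g x) := by gcongr
        _ = K * (2 * K + 1)⁻¹ * ∫ x, ζ x * g x := by ring
        _ ≤ _ := by gcongr
    rw [mul_add] at h6
    linarith
  have hlim : Tendsto (fun k => ∫ x in Metric.ball x₀ (R k), g x) atTop (𝓝 (∫ x, g x)) :=
    hcover.integral_tendsto_of_countably_generated hint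
  have hδ : ∀ δ : ℝ, 0 < δ → ∫ x, g x ≤ K * δ ^ (q - 1) := by
    intro δ hδ
    have hlim2 : Tendsto (fun k => K * (δ⁻¹ * ((∫ x, g x) - ∫ x in Metric.ball x₀ (R k), g x)
        + δ ^ (q - 1))) atTop (𝓝 (K * (δ⁻¹ * ((∫ x, g x) - ∫ x, g x) + δ ^ (q - 1)))) :=
      (((hlim.const_sub _).const_mul _).add_const _).const_mul _
    rw [sub_self, mul_zero, zero_add] at hlim2
    refine le_of_tendsto_of_tendsto hlim hlim2 ?_
    filter_upwards [h] with k hk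
    obtain ⟨ζ, h1, h2, h3, h4, h5⟩ := hk
    refine (hle k ζ h1 h2 h4).trans ((h5 δ hδ).trans ?_)
    gcongr
    -- The annulus lies outside `B(x₀, R k)`, so its integral is at most `∫ g` minus the integral
    -- over that ball, and this difference tends to zero.
    have hsplit := integral_add_compl (measurableSet_ball (x := x₀) (ε := R k)) hint
    calc ∫ x in Metric.ball x₀ (2 * R k) \ Metric.ball x₀ (R k), ζ x * g x
        ≤ ∫ x in Metric.ball x₀ (2 * R k) \ Metric.ball x₀ (R k), g x :=
          integral_mono h1.integrableOn hint.integrableOn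
            fun x => mul_le_of_le_one_left (hg0 x) (h3 x)
      _ ≤ ∫ x in (Metric.ball x₀ (R k))ᶜ, g x :=
          setIntegral_mono_set hint.integrableOn (Eventually.of_forall hg0)
            (Eventually.of_forall fun x hx => hx.2)
      _ = _ := by linarith
  have hzero : ∫ x, g x ≤ 0 := by
    have hlim3 : Tendsto (fun δ : ℝ => K * δ ^ (q - 1)) (𝓝[>] 0) (𝓝 (K * 0 ^ (q - 1))) :=
      ((Real.continuousAt_rpow_const 0 (q - 1) (Or.inr (by linarith))).tendsto.mono_left
        nhdsWithin_le_nhds).const_mul K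
    rw [Real.zero_rpow (by linarith), mul_zero] at hlim3
    exact ge_of_tendsto hlim3 (eventually_mem_nhdsWithin.mono fun δ hδ' => hδ δ hδ')
  exact (integral_eq_zero_iff_of_nonneg hg0 hint).1
    (le_antisymm hzero (integral_nonneg hg0))

end VariableExponent

theorem corollary3p5 (n : ℕ) (hn : 2 ≤ n)
    (p : VariableExponent.Rn n → ℝ) (hp : VariableExponent.IsLogHolderExponent p)
    (A : VariableExponent.Rn n → ℝ → VariableExponent.Rn n → VariableExponent.Rn n)
    (hA : VariableExponent.HasNonstandardGrowth p A)
    (q : ℝ) (hq : (n : ℝ) ≤ q)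
    (x₀ : VariableExponent.Rn n) (R : ℕ → ℝ) (hRmono : Monotone R)
    (hRlim : Tendsto R atTop atTop)
    (hpq : ∀ k : ℕ, ∀ x ∈ Metric.ball x₀ (2 * R k) \ Metric.ball x₀ (R k), p x = q)
    (u : VariableExponent.Rn n → ℝ) (hu : VariableExponent.IsAHarmonic p A u)
    (hbdd : ∃ M : ℝ, ∀ x, |u x| ≤ M) :
    ∃ c : ℝ, ∀ x, u x = c := by
  obtain ⟨M, hM⟩ := hbdd
  obtain ⟨hcont, G, huG, htest⟩ := hu
  have hq1 : 1 < q := by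
    have : (2 : ℝ) ≤ n := by exact_mod_cast hn
    linarith
  obtain ⟨K, hK, hcac⟩ :=
    VariableExponent.exists_caccioppoli hp hA hq1 hq hcont huG htest hM
  have hg := VariableExponent.ae_eq_zero_of_caccioppoli (g := fun x => ‖G x‖ ^ p x)
    (fun x => by positivity) (fun r => huG.integrableOn_closedBall hp x₀ r) hRlim hK hq1
    ((hRlim.eventually_ge_atTop 1).mono fun k hk => hcac x₀ (R k) hk (hpq k))
  have hG : G =ᵐ[volume] 0 := by
    filter_upwards [hg] with x hx
    have hx' : ‖G x‖ ^ p x = 0 := hx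
    exact norm_eq_zero.1 ((Real.rpow_eq_zero (norm_nonneg _) (by linarith [hp.one_lt x])).1 hx')
  exact ⟨u 0, fun x => huG.weakGradient.eq_of_ae_eq_zero hcont hG x 0⟩
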